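/- Let $q\ge 2$ be an integer. For $a\in\mathbb Z_q=\mathbb Z/q\mathbb Z$ with representative $r\in\{0,\dots,q-1\}$ let $|a|_L=\min(r,q-r)$ be its Lee weight, and for words $x,y\in\mathbb Z_q^5$ let $\rho_L(x,y)=\sum_{i=1}^5|x_i-y_i|_L$ be their Lee distance. A perfect $1$-error-correcting Lee code of block length $5$ over $\mathbb Z_q$ (a $PL(5,q,1)$ code) is a set $M\subseteq\mathbb Z_q^5$ such that every word $x\in\mathbb Z_q^5$ is at Lee distance at most $1$ from exactly one element of $M$. Then a $PL(5,q,1)$ code exists if and only if $11\mid q$. -/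

import Mathlib

/-- The Lee weight of a residue `a` modulo `q` (with `q ≥ 1`): the smaller of `r` and `q - r`,
where `r ∈ {0, …, q - 1}` represents `a`. -/
def leeWeight {q : ℕ} (a : ZMod q) : ℕ := min a.val (q - a.val)

/-- The Lee distance between two words of length `n` over `ZMod q`. -/
def leeDist {n q : ℕ} (x y : Fin n → ZMod q) : ℕ := ∑ i, leeWeight (x i - y i)

/-- `M` is a perfect `e`-error-correcting Lee code of block length `n` over `ZMod q`:
every word is at Lee distance at most `e` from exactly one codeword. -/
def IsPerfectLeeCode (n q e : ℕ) (M : Set (Fin n → ZMod q)) : Prop :=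
  ∀ x : Fin n → ZMod q, ∃! w : Fin n → ZMod q, w ∈ M ∧ leeDist x w ≤ e

/-! Unit spheres around the codewords partition the space. For `3 ≤ q` a sphere has 11 words, so 11
divides `q ^ 5` and, being prime, divides `q`. Conversely, if `11 ∣ q`, the syndrome `∑ (i + 1) xᵢ`
mod 11 takes the values 0, ±1, …, ±5 on the sphere, each residue once; hence its kernel is a perfect
code. -/

theorem leeWeight_eq_zero {q : ℕ} [NeZero q] (a : ZMod q) : leeWeight a = 0 ↔ a = 0 := by
  have h := ZMod.val_lt a
  rw [← ZMod.val_eq_zero a, leeWeight]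
  omega

theorem leeWeight_eq_one {q : ℕ} (hq : 2 ≤ q) (a : ZMod q) :
    leeWeight a = 1 ↔ a = 1 ∨ a = -1 := by
  have : NeZero q := ⟨by omega⟩
  have : Fact (1 < q) := ⟨hq⟩
  have h := ZMod.val_lt a
  have h1 : a = 1 ↔ a.val = 1 := by
    rw [← (ZMod.val_injective q).eq_iff, ZMod.val_one]
  have h2 : a = -1 ↔ a.val = q - 1 := by
    rw [← (ZMod.val_injective q).eq_iff, ZMod.neg_val, if_neg one_ne_zero, ZMod.val_one]
  rw [h1, h2, leeWeight]
  omega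

/-- The centre (`none`) and the arms `±eᵢ` of the unit Lee sphere of `ZMod q ^ n`. -/
def leeSphere {n q : ℕ} : Option (Fin n × Bool) → Fin n → ZMod q
  | none => 0
  | some (i, s) => Pi.single i (if s then 1 else -1)

theorem leeDist_le_one_iff {n q : ℕ} (hq : 2 ≤ q) (x w : Fin n → ZMod q) :
    leeDist x w ≤ 1 ↔ ∃ o, leeSphere o = x - w := by
  have : NeZero q := ⟨by omega⟩
  have key : leeDist x w = ∑ i, leeWeight ((x - w) i) := rfl
  rw [key]
  generalize x - w = v
  constructor
  · intro h
    by_cases hv : ∀ i, v i = 0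
    · exact ⟨none, by ext i; simp [leeSphere, hv i]⟩
    · push Not at hv
      obtain ⟨i, hi⟩ := hv
      have hpos : leeWeight (v i) ≠ 0 := mt (leeWeight_eq_zero _).1 hi
      rw [← Finset.add_sum_erase _ _ (Finset.mem_univ i)] at h
      have hrest : ∑ j ∈ Finset.univ.erase i, leeWeight (v j) = 0 := by omega
      have hz : ∀ j, j ≠ i → v j = 0 := fun j hj =>
        (leeWeight_eq_zero _).1 (Finset.sum_eq_zero_iff.1 hrest j (by simp [hj]))
      have hsingle : Pi.single i (v i) = v := by
        ext j
        by_cases hj : j = i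
        · subst hj; simp
        · simp [hj, hz j hj]
      rcases (leeWeight_eq_one hq (v i)).1 (by omega) with h1 | h1
      · exact ⟨some (i, true), by rw [← hsingle, h1]; simp [leeSphere]⟩
      · exact ⟨some (i, false), by rw [← hsingle, h1]; simp [leeSphere]⟩
  · rintro ⟨_ | ⟨i, s⟩, rfl⟩
    · simp [leeSphere, (leeWeight_eq_zero (0 : ZMod q)).2 rfl]
    · rw [Finset.sum_eq_single i]
      · refine ((leeWeight_eq_one hq _).2 ?_).le
        cases s <;> simp [leeSphere]
      · intro j _ hj
        simp [leeSphere, hj, leeWeight_eq_zero]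
      · simp

theorem leeSphere_injective {n q : ℕ} (hq : 3 ≤ q) :
    Function.Injective (leeSphere : Option (Fin n × Bool) → Fin n → ZMod q) := by
  have : Fact (1 < q) := ⟨by omega⟩
  have : Fact (2 < q) := ⟨hq⟩
  have hne : (-1 : ZMod q) ≠ 1 := ZMod.neg_one_ne_one
  have hs : ∀ s : Bool, (if s then 1 else -1 : ZMod q) ≠ 0 := by rintro ⟨_ | _⟩ <;> simp
  rintro (_ | ⟨i, s⟩) (_ | ⟨j, t⟩) h
  · rfl
  · exact absurd (Pi.single_eq_zero_iff.1 h.symm) (hs t)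
  · exact absurd (Pi.single_eq_zero_iff.1 h) (hs s)
  · simp only [leeSphere] at h
    have hij : i = j := by
      by_contra hij
      have := congrFun h i
      rw [Pi.single_eq_same, Pi.single_eq_of_ne hij] at this
      exact hs s this
    subst hij
    have hst := Pi.single_injective i h
    cases s <;> cases t <;> simp_all [hne.symm]

/-- The spheres around the words of a perfect code partition the space. -/
theorem IsPerfectLeeCode.card_mul_card_range {n q : ℕ} (hq : 2 ≤ q)
    {M : Set (Fin n → ZMod q)} (hM : IsPerfectLeeCode n q 1 M) :
    Nat.card M * Nat.card (Set.range (leeSphere : Option (Fin n × Bool) → Fin n → ZMod q)) =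
      q ^ n := by
  have : NeZero q := ⟨by omega⟩
  have hcard : Nat.card (Fin n → ZMod q) = q ^ n := by simp
  rw [← hcard, ← Nat.card_prod]
  refine Nat.card_congr (Equiv.ofBijective (fun p => p.1.1 + p.2.1) ⟨?_, fun x => ?_⟩)
  · rintro ⟨⟨m, hm⟩, b, o, rfl⟩ ⟨⟨m', hm'⟩, b', o', rfl⟩ h
    simp only at h
    obtain rfl : m = m' := (hM (m + leeSphere o)).unique
      ⟨hm, (leeDist_le_one_iff hq _ _).2 ⟨o, by simp⟩⟩
      ⟨hm', (leeDist_le_one_iff hq _ _).2 ⟨o', by simp [h]⟩⟩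
    simp [add_left_cancel h]
  · obtain ⟨w, ⟨hw, hd⟩, -⟩ := hM x
    exact ⟨⟨⟨w, hw⟩, x - w, (leeDist_le_one_iff hq x w).1 hd⟩, by simp⟩

theorem IsPerfectLeeCode.eleven_dvd {q : ℕ} (hq : 2 ≤ q) {M : Set (Fin 5 → ZMod q)}
    (hM : IsPerfectLeeCode 5 q 1 M) : 11 ∣ q := by
  have h := hM.card_mul_card_range hq
  obtain rfl | hq3 := hq.eq_or_lt
  -- For `q = 2` the arms `eᵢ` and `-eᵢ` coincide: the sphere has 6 words, and 6 does not divide 32.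
  · have hr : Set.range (leeSphere : Option (Fin 5 × Bool) → Fin 5 → ZMod 2) =
        ↑(Finset.univ.image (leeSphere : Option (Fin 5 × Bool) → Fin 5 → ZMod 2)) := by simp
    have hc : (Finset.univ.image (leeSphere : Option (Fin 5 × Bool) → Fin 5 → ZMod 2)).card = 6 :=
      by decide
    rw [hr, Nat.card_coe_set_eq _, Nat.card_coe_set_eq _, Set.ncard_coe_finset, hc] at h
    omega
  · rw [Nat.card_range_of_injective (leeSphere_injective hq3)] at h
    refine Nat.Prime.dvd_of_dvd_pow (by norm_num) (n := 5) (Dvd.intro_left (Nat.card M) ?_) (p := 11)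
    simpa using h

/-- The syndrome `∑ (i + 1) xᵢ` modulo 11. -/
def leeSyndrome {q : ℕ} (h : 11 ∣ q) (x : Fin 5 → ZMod q) : ZMod 11 :=
  ∑ i : Fin 5, ((i : ℕ) + 1 : ZMod 11) * ZMod.castHom h (ZMod 11) (x i)

theorem leeSyndrome_sub {q : ℕ} (h : 11 ∣ q) (x y : Fin 5 → ZMod q) :
    leeSyndrome h (x - y) = leeSyndrome h x - leeSyndrome h y := by
  simp only [leeSyndrome, Pi.sub_apply, map_sub, mul_sub, Finset.sum_sub_distrib]

/-- Passing to `q = 11` makes bijectivity on the sphere a single finite check, open to `decide`. -/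
theorem leeSyndrome_leeSphere {q : ℕ} (h : 11 ∣ q) (o : Option (Fin 5 × Bool)) :
    leeSyndrome h (leeSphere o) = leeSyndrome dvd_rfl (leeSphere o) := by
  rcases o with _ | ⟨i, s⟩
  · simp [leeSyndrome, leeSphere]
  · have key : ∀ {q : ℕ} (h : 11 ∣ q), leeSyndrome h (leeSphere (some (i, s))) =
        ((i : ℕ) + 1 : ZMod 11) * (if s then 1 else -1) := by
      intro q h
      rw [leeSyndrome, Finset.sum_eq_single i]
      · cases s <;> simp only [leeSphere, Pi.single_eq_same, map_neg, map_one, if_true, if_false,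
          Bool.false_eq_true]
      · intro j _ hj
        simp [leeSphere, hj]
      · simp
    rw [key, key]

theorem leeSyndrome_leeSphere_bijective {q : ℕ} (h : 11 ∣ q) :
    Function.Bijective fun o => leeSyndrome h (leeSphere o) := by
  simp only [leeSyndrome_leeSphere h]
  decide

theorem isPerfectLeeCode_leeSyndrome {q : ℕ} (hq : 2 ≤ q) (h : 11 ∣ q) :
    IsPerfectLeeCode 5 q 1 {x | leeSyndrome h x = 0} := by
  intro x
  obtain ⟨o, ho⟩ := (leeSyndrome_leeSphere_bijective h).2 (leeSyndrome h x)
  simp only at ho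
  refine ⟨x - leeSphere o, ⟨?_, (leeDist_le_one_iff hq _ _).2 ⟨o, by simp⟩⟩, ?_⟩
  · rw [Set.mem_ofPred_eq, leeSyndrome_sub, ho, sub_self]
  · rintro w ⟨hw, hd⟩
    obtain ⟨o', ho'⟩ := (leeDist_le_one_iff hq _ _).1 hd
    -- A codeword has syndrome 0, so `x - w` has the syndrome of `x`, which determines the sphere
    -- element.
    obtain rfl : o' = o := (leeSyndrome_leeSphere_bijective h).1 <| by
      simp only [ho, ho', leeSyndrome_sub]
      rw [show leeSyndrome h w = 0 from hw, sub_zero]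
    rw [ho', sub_sub_cancel]

theorem mainTheorem4 (q : ℕ) (hq : 2 ≤ q) :
    (∃ M : Set (Fin 5 → ZMod q), IsPerfectLeeCode 5 q 1 M) ↔ 11 ∣ q :=
  ⟨fun ⟨_, hM⟩ => hM.eleven_dvd hq, fun h => ⟨_, isPerfectLeeCode_leeSyndrome hq h⟩⟩
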